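/- Let $\Gamma$ be a finite graph in the sense of Serre (loops and multiple edges are allowed, and $\Gamma$ need not be connected), with vertex set $V$, set of oriented edges $\vec E$, source and target maps $s,t$, a fixed-point free reversal involution $\vec e\mapsto \bar e$ on $\vec E$ with $s(\vec e)=t(\bar e)$, and set $E$ of unoriented edges. Let $C_1(\Gamma,A)$ be the module of $1$-chains, generated by $\vec E$ with the relations $\bar e=-\vec e$; let $\partial\vec e=t(\vec e)-s(\vec e)$ and $H_1(\Gamma,A)=\ker\partial\subseteq C_1(\Gamma,A)$. Let $(\cdot,\cdot)$ be the scalar product on $C_1(\Gamma,\mathbb R)$ with $(\vec e,\vec e)=1$, $(\vec e,\bar e)=-1$ and $(\vec e,\vec f)=0$ if $\vec f\ne\vec e,\bar e$, restricted to $H_1(\Gamma,\mathbb R)$. Then the following four posets are isomorphic. 1. The poset $\mathcal{OP}_\Gamma$ of totally cyclic orientations. Its elements are the pairs $(T,\phi)$ with $T\subseteq E$ and $\phi$ a totally cyclic orientation of $\Gamma\setminus T$ (the graph with the same vertices and the edges in $T$ removed), and $(T',\phi')\le(T,\phi)$ if and only if $T\subseteq T'$ and $\phi'$ is the restriction of $\phi$.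 Here an orientation of a graph is totally cyclic if no connected component, with vertex set $K$, has a nonempty proper subset $W\subset K$ such that every edge between $W$ and $K\setminus W$ is oriented from $W$ to $K\setminus W$. 2. The poset of nonempty faces of the Voronoi polytope $\mathrm{Vor}_\Gamma=\{v\in H_1(\Gamma,\mathbb R): (v,v)\le(v-\lambda,v-\lambda)\text{ for all }\lambda\in H_1(\Gamma,\mathbb Z)\}$ (including $\mathrm{Vor}_\Gamma$ itself), ordered by reverse inclusion. 3. The poset, ordered by inclusion, of cones of the normal fan of $\mathrm{Vor}_\Gamma$, that is, of the cones $C_\delta=\{\alpha\in H_1(\Gamma,\mathbb R):(\alpha,r)\ge(\alpha,r')\text{ for all }r\in\delta,\ r'\in\mathrm{Vor}_\Gamma\}$ for the nonempty faces $\delta$ of $\mathrm{Vor}_\Gamma$. 4. The poset, ordered by inclusion, of cones of the cographic fan $\mathcal F_\Gamma^\perp$. Its cones are the closures of the connected components of the complement in $H_1(\Gamma,\mathbb R)$ of the cographic arrangement (the union of those subspaces $\{v\in H_1(\Gamma,\mathbb R):(v,e)=0\}$, $e\in E$, that are proper), together with all nonempty faces of these closures. -/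

import Mathlib

/-- A graph in the sense of Serre, with vertex set `V` and set of oriented edges `D`: source and
target maps and a fixed-point free involution `rev` on oriented edges with `s e = t (rev e)`.
Loops and multiple edges are allowed. -/
structure SerreGraph (V : Type*) (D : Type*) where
  src : D → V
  tgt : D → V
  rev : D → D
  rev_rev : ∀ d, rev (rev d) = d
  rev_ne : ∀ d, rev d ≠ d
  src_eq : ∀ d, src d = tgt (rev d)

namespace SerreGraph

variable {V D : Type*}

/-! ### Edges, orientations, deletion -/

/-- Two oriented edges are equivalent if they agree up to reversal. -/
def edgeSetoid (Γ : SerreGraph V D) : Setoid D where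
  r a b := b = a ∨ b = Γ.rev a
  iseqv :=
    { refl := fun _ => Or.inl rfl
      symm := by
        rintro a b (h | h)
        · exact Or.inl h.symm
        · exact Or.inr (by rw [h, Γ.rev_rev])
      trans := by
        rintro a b c (h | h) (h' | h')
        · exact Or.inl (h'.trans h)
        · exact Or.inr (by rw [h', h])
        · exact Or.inr (h'.trans h)
        · exact Or.inl (by rw [h', h, Γ.rev_rev]) }

/-- The set `E(Γ)` of unoriented edges. -/
def Edge (Γ : SerreGraph V D) : Type _ := Quotient Γ.edgeSetoid

/-- The unoriented edge underlying an oriented edge. -/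
def edge (Γ : SerreGraph V D) (d : D) : Γ.Edge := Quotient.mk Γ.edgeSetoid d

theorem edge_eq_iff (Γ : SerreGraph V D) (a b : D) :
    Γ.edge a = Γ.edge b ↔ b = a ∨ b = Γ.rev a :=
  ⟨fun h => Quotient.exact h, fun h => Quotient.sound (s := Γ.edgeSetoid) h⟩

theorem edge_rev (Γ : SerreGraph V D) (d : D) : Γ.edge (Γ.rev d) = Γ.edge d :=
  ((Γ.edge_eq_iff _ _).2 (Or.inr rfl)).symm

/-- An orientation of `Γ`: a section `E(Γ) → D` of the quotient map. -/
@[ext]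
structure Orientation (Γ : SerreGraph V D) where
  toFun : Γ.Edge → D
  edge_toFun : ∀ e, Γ.edge (toFun e) = e

/-- The spanning subgraph `Γ ∖ T`: same vertices, the edges in `T` removed. -/
def delete (Γ : SerreGraph V D) (T : Set Γ.Edge) : SerreGraph V {d : D // Γ.edge d ∉ T} where
  src d := Γ.src d
  tgt d := Γ.tgt d
  rev d := ⟨Γ.rev d, by rw [Γ.edge_rev]; exact d.2⟩
  rev_rev d := Subtype.ext (Γ.rev_rev d)
  rev_ne d h := Γ.rev_ne d (congrArg Subtype.val h)
  src_eq d := Γ.src_eq d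

/-- If `T ⊆ T'`, the inclusion `E(Γ ∖ T') ⊆ E(Γ ∖ T)`. -/
def deleteIncl (Γ : SerreGraph V D) {T T' : Set Γ.Edge} (h : T ⊆ T') :
    (Γ.delete T').Edge → (Γ.delete T).Edge :=
  Quotient.map (fun d => ⟨d.1, fun hd => d.2 (h hd)⟩) (by
    rintro a b (hab | hab)
    · exact Or.inl (by rw [hab])
    · exact Or.inr (by rw [hab]; rfl))

/-! ### Totally cyclic orientations -/

/-- The vertex set of the connected component of `v`. -/
def component (Γ : SerreGraph V D) (v : V) : Set V :=
  {w | Relation.ReflTransGen (fun x y => ∃ d, Γ.src d = x ∧ Γ.tgt d = y) v w}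

/-- An orientation is totally cyclic if no connected component `K` has a nonempty proper subset
`W` of vertices such that all the edges between `W` and `K ∖ W` are oriented from `W` to
`K ∖ W`. -/
def Orientation.TotallyCyclic {Γ : SerreGraph V D} (φ : Γ.Orientation) : Prop :=
  ∀ v : V, ¬ ∃ W : Set V, W.Nonempty ∧ W ⊂ Γ.component v ∧
    ∀ d : D, Γ.src d ∈ W → Γ.tgt d ∈ Γ.component v \ W →
      Γ.src (φ.toFun (Γ.edge d)) ∈ W ∧ Γ.tgt (φ.toFun (Γ.edge d)) ∈ Γ.component v \ W

/-- Elements of the poset `OP_Γ`: pairs `(T, φ)` of a set `T` of edges and a totally cyclic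
orientation `φ` of `Γ ∖ T`. -/
structure OP (Γ : SerreGraph V D) where
  T : Set Γ.Edge
  φ : (Γ.delete T).Orientation
  totallyCyclic : φ.TotallyCyclic

/-- `(T', φ') ≤ (T, φ)` iff `Γ ∖ T' ⊆ Γ ∖ T` and `φ'` is the restriction of `φ`. -/
instance (Γ : SerreGraph V D) : PartialOrder Γ.OP where
  le p q := ∃ h : q.T ⊆ p.T, ∀ e : (Γ.delete p.T).Edge,
    (p.φ.toFun e : D) = (q.φ.toFun (Γ.deleteIncl h e) : D)
  le_refl p := ⟨subset_rfl, fun e => by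
    induction e using Quotient.inductionOn with
    | h d => rfl⟩
  le_trans p q r := by
    rintro ⟨h₁, h₁'⟩ ⟨h₂, h₂'⟩
    refine ⟨h₂.trans h₁, fun e => ?_⟩
    rw [h₁', h₂']
    induction e using Quotient.inductionOn with
    | h d => rfl
  le_antisymm p q := by
    rintro ⟨h₁, h₁'⟩ ⟨h₂, -⟩
    obtain ⟨T, φ, hφ⟩ := p
    obtain ⟨T', φ', hφ'⟩ := q
    obtain rfl : T = T' := h₂.antisymm h₁
    have : φ = φ' := by
      ext e
      rw [h₁' e]
      induction e using Quotient.inductionOn with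
      | h d => rfl
    subst this
    rfl

/-! ### Homology -/

section Homology

/-- The module of `1`-chains with coefficients in `A`. A chain is stored by its coefficients:
`c d` is the coefficient of the oriented edge `d`, so that reversing `d` changes the sign. For a
finite graph this is the module generated by the oriented edges (see `orientedEdge`) subject to
the relations `rev d = - d`. -/
def chains (Γ : SerreGraph V D) (A : Type*) [CommRing A] : Submodule A (D → A) where
  carrier := {c | ∀ d, c (Γ.rev d) = - c d}
  add_mem' := by
    intro a b ha hb d
    simp only [Pi.add_apply, ha d, hb d]
    ring
  zero_mem' := by intro d; simp
  smul_mem' := by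
    intro r a ha d
    simp only [Pi.smul_apply, ha d, smul_neg]

open Classical in
/-- The oriented edge `d` as a `1`-chain. -/
noncomputable def orientedEdge (Γ : SerreGraph V D) (A : Type*) [CommRing A] (d : D) :
    Γ.chains A :=
  ⟨fun d' => (if d' = d then 1 else 0) - (if d' = Γ.rev d then 1 else 0), fun d' => by
    have h₁ : Γ.rev d' = d ↔ d' = Γ.rev d :=
      ⟨fun h => by rw [← h, Γ.rev_rev], fun h => by rw [h, Γ.rev_rev]⟩
    have h₂ : Γ.rev d' = Γ.rev d ↔ d' = d :=
      ⟨fun h => by rw [← Γ.rev_rev d', h, Γ.rev_rev], fun h => by rw [h]⟩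
    simp only [h₁, h₂, neg_sub]⟩

open Classical in
/-- The boundary map, sending an oriented edge `d` to `tgt d - src d`
(see `boundary_orientedEdge`). -/
noncomputable def boundary (Γ : SerreGraph V D) (A : Type*) [CommRing A] [Fintype D] :
    Γ.chains A →ₗ[A] (V → A) where
  toFun c v := ∑ d with Γ.tgt d = v, c.1 d
  map_add' a b := by
    ext v
    simp [Finset.sum_add_distrib]
  map_smul' r a := by
    ext v
    simp [Finset.mul_sum]

/-- The first homology `H_1(Γ, A)`, the kernel of the boundary map. -/
noncomputable abbrev H1 (Γ : SerreGraph V D) (A : Type*) [CommRing A] [Fintype D] :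
    Submodule A (Γ.chains A) :=
  LinearMap.ker (Γ.boundary A)

/-- The natural map `H_1(Γ, ℤ) → H_1(Γ, ℝ)`. -/
noncomputable def intCast (Γ : SerreGraph V D) [Fintype D] (c : Γ.H1 ℤ) : Γ.H1 ℝ :=
  ⟨⟨fun d => ((c.1.1 d : ℤ) : ℝ), fun d => by
    have h := c.1.2 d
    simp only [h, Int.cast_neg]⟩, by
    classical
    have h := c.2
    rw [LinearMap.mem_ker] at h ⊢
    ext v
    have hv := congrArg (fun z : ℤ => (z : ℝ)) (congrFun h v)
    simpa [boundary] using hv⟩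

/-- The scalar product on `1`-chains, for which the oriented edges of any orientation form an
orthonormal basis; the factor `1/2` appears because the sum runs over both orientations of every
edge. -/
noncomputable def pairing (Γ : SerreGraph V D) [Fintype D] (x y : Γ.chains ℝ) : ℝ :=
  (1 / 2) * ∑ d, x.1 d * y.1 d

theorem orientedEdge_rev (Γ : SerreGraph V D) (A : Type*) [CommRing A] (d : D) :
    Γ.orientedEdge A (Γ.rev d) = - Γ.orientedEdge A d := by
  ext d'
  have h : d' = Γ.rev (Γ.rev d) ↔ d' = d := by rw [Γ.rev_rev]
  simp only [orientedEdge, NegMemClass.coe_neg, Pi.neg_apply, neg_sub]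
  by_cases hd : d' = d
  · rw [if_pos (h.2 hd), if_pos hd]
  · rw [if_neg (fun h' => hd (h.1 h')), if_neg hd]

/-- Every chain is the combination of positively oriented edges given by its coefficients. -/
theorem chain_eq_sum (Γ : SerreGraph V D) (A : Type*) [CommRing A] [Fintype Γ.Edge]
    (φ : Γ.Orientation) (c : Γ.chains A) :
    c = ∑ e, c.1 (φ.toFun e) • Γ.orientedEdge A (φ.toFun e) := by
  classical
  ext d
  simp only [AddSubmonoidClass.coe_finsetSum, Finset.sum_apply, SetLike.val_smul, Pi.smul_apply,
    smul_eq_mul]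
  rw [Finset.sum_eq_single (Γ.edge d)]
  · have h := φ.edge_toFun (Γ.edge d)
    rw [edge_eq_iff] at h
    rcases h with h | h
    · rw [← h]
      simp [orientedEdge, (Γ.rev_ne d).symm]
    · have h2 : φ.toFun (Γ.edge d) = Γ.rev d := by
        rw [h, Γ.rev_rev, ← h]
      rw [h2, c.2 d]
      simp [orientedEdge, Γ.rev_rev, (Γ.rev_ne d).symm]
  · intro e _ he
    have h1 : d ≠ φ.toFun e := fun h => he (by rw [h, φ.edge_toFun])
    have h2 : d ≠ Γ.rev (φ.toFun e) := fun h => he (by rw [h, Γ.edge_rev, φ.edge_toFun])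
    simp [orientedEdge, h1, h2]
  · simp

open Classical in
theorem boundary_orientedEdge (Γ : SerreGraph V D) (A : Type*) [CommRing A] [Fintype D] (d : D) :
    Γ.boundary A (Γ.orientedEdge A d) = Pi.single (Γ.tgt d) 1 - Pi.single (Γ.src d) 1 := by
  ext v
  simp [boundary, orientedEdge, Finset.sum_sub_distrib, Pi.single_apply, Γ.src_eq, eq_comm]

theorem pairing_orientedEdge (Γ : SerreGraph V D) [Fintype D] (d : D) (c : Γ.chains ℝ) :
    Γ.pairing (Γ.orientedEdge ℝ d) c = c.1 d := by
  classical
  simp [pairing, orientedEdge, sub_mul, Finset.sum_sub_distrib, c.2 d]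
  ring

end Homology

/-! ### The Voronoi polytope and the fans -/

section Fans

variable [Fintype D]

/-- A face of a convex set `P`: a nonempty set of maximizers on `P` of a linear functional
(`P` itself is the face of the zero functional). -/
def IsFace {E : Type*} [AddCommGroup E] [Module ℝ E] [TopologicalSpace E] (P F : Set E) : Prop :=
  F.Nonempty ∧ IsExposed ℝ P F

/-- The Voronoi polytope. -/
noncomputable def voronoi (Γ : SerreGraph V D) : Set (Γ.H1 ℝ) :=
  {v | ∀ l : Γ.H1 ℤ,
    Γ.pairing v v ≤ Γ.pairing (v - Γ.intCast l : Γ.H1 ℝ) (v - Γ.intCast l : Γ.H1 ℝ)}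

/-- The (nonempty) faces of the Voronoi polytope, ordered by inclusion. -/
abbrev VoronoiFaces (Γ : SerreGraph V D) : Type _ :=
  {F : Set (Γ.H1 ℝ) // IsFace Γ.voronoi F}

/-- The normal cone `C_δ` of a face `δ` of the Voronoi polytope. -/
noncomputable def normalCone (Γ : SerreGraph V D) (δ : Set (Γ.H1 ℝ)) : Set (Γ.H1 ℝ) :=
  {a | ∀ r ∈ δ, ∀ r' ∈ Γ.voronoi, Γ.pairing a r' ≤ Γ.pairing a r}

/-- The normal fan of the Voronoi polytope: the set of the normal cones of its faces. -/
noncomputable def normalFan (Γ : SerreGraph V D) : Set (Set (Γ.H1 ℝ)) :=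
  {C | ∃ δ, IsFace Γ.voronoi δ ∧ C = Γ.normalCone δ}

/-- The linear subspace `{v ∈ H_1(Γ, ℝ) : (v, e) = 0}` for an edge `e`. -/
noncomputable def edgeKer (Γ : SerreGraph V D) (e : Γ.Edge) : Set (Γ.H1 ℝ) :=
  {v | ∀ d, Γ.edge d = e → Γ.pairing (Γ.orientedEdge ℝ d) v = 0}

/-- The union of the hyperplanes of the cographic arrangement: the subspaces `(·, e) = 0` that are
proper. -/
noncomputable def cographicArrangement (Γ : SerreGraph V D) : Set (Γ.H1 ℝ) :=
  ⋃ e ∈ {e : Γ.Edge | Γ.edgeKer e ≠ Set.univ}, Γ.edgeKer e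

/-- The cographic fan: the closed cones into which the cographic arrangement divides
`H_1(Γ, ℝ)`, that is, the closures of the connected components of the complement of the
arrangement, together with all their faces. -/
noncomputable def cographicFan (Γ : SerreGraph V D) : Set (Set (Γ.H1 ℝ)) :=
  {σ | ∃ x ∈ (Γ.cographicArrangement)ᶜ,
    IsFace (closure (connectedComponentIn (Γ.cographicArrangement)ᶜ x)) σ}

end Fans

end SerreGraph

/-!
The sign vectors of real circulations describe all four posets. Since chains are odd under
reversal, the signs of the coefficients of `v ∈ H_1(Γ, ℝ)` are recorded by the set `posSupp v` of
oriented edges with positive coefficient, and the nonzero coefficients of `w` have the same signs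
as those of `v` (`w` is *conformal* to `v`) exactly when `posSupp w ⊆ posSupp v`. Each poset is
identified with the set of all `posSupp v`, ordered by inclusion.

* Orientations. An orientation of `Γ ∖ T` is totally cyclic if and only if some circulation is
  positive along it and vanishes on `T`. Given total cyclicity, the source of an oriented edge can
  be reached from its target, since otherwise the set of unreachable vertices gives a directed cut;
  summing the resulting cycles gives the circulation (`OP.exists_posSupp_eq`). Conversely, the net
  flow of a circulation across a cut is zero, so that no cut is directed (`exists_posSet_eq`).

* Cographic fan. The components of the complement of the arrangement are the cells of constant sign,
  their closures are the cones `signCone (posSupp x)` of classes conformal to `x`, and the faces of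
  such a cone are the cones of the same kind for the classes conformal to `x` (`cographicFan_eq`).

* Voronoi polytope. It is the orthogonal projection of the cube `[-1/2, 1/2]^E`
  (`mem_voronoi_iff_exists_cube`). One inclusion is `|k| ≤ k ^ 2` for integers `k`. For the other,
  the support functions are compared: every real circulation is a conformal nonnegative combination of
  integral ones with coefficients in `{-1, 0, 1}`, and for those the defining inequality of the
  polytope is the bound by half the `ℓ¹`-norm (`pairing_le_width`). Hence the face on which
  `pairing a` is maximal is the projection of the face of the cube fixed by the signs of `a`, faces
  are contained in each other according to the reverse inclusion of positive supports
  (`voronoiFace_subset_iff`), and the normal cone of this face is `signCone (posSupp a)`, so that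
  the normal fan equals the cographic fan.
-/

namespace SerreGraph

variable {V D : Type*}

/-! ### Positive supports and the scalar product -/

/-- The set of oriented edges on which a real chain is positive. Since chains are odd under
reversal, this set records the sign of every coefficient. -/
def posSupp (Γ : SerreGraph V D) (c : Γ.chains ℝ) : Set D := {d | 0 < c.1 d}

section

variable {Γ : SerreGraph V D}

theorem mem_posSupp {c : Γ.chains ℝ} {d : D} : d ∈ Γ.posSupp c ↔ 0 < c.1 d := Iff.rfl

theorem rev_mem_posSupp {c : Γ.chains ℝ} {d : D} : Γ.rev d ∈ Γ.posSupp c ↔ c.1 d < 0 := by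
  rw [mem_posSupp, c.2 d]
  exact neg_pos

/-- A chain conformal to `c` has no negative coefficient where that of `c` is nonnegative. -/
theorem nonneg_of_posSupp_subset {b c : Γ.chains ℝ} (h : Γ.posSupp b ⊆ Γ.posSupp c) {d : D}
    (hd : 0 ≤ c.1 d) : 0 ≤ b.1 d := by
  by_contra! hb
  exact absurd (rev_mem_posSupp.1 (h (rev_mem_posSupp.2 hb))) hd.not_gt

theorem nonpos_of_posSupp_subset {b c : Γ.chains ℝ} (h : Γ.posSupp b ⊆ Γ.posSupp c) {d : D}
    (hd : c.1 d ≤ 0) : b.1 d ≤ 0 := by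
  by_contra! hb
  exact absurd (h hb) hd.not_gt

theorem eq_zero_of_posSupp_subset {b c : Γ.chains ℝ} (h : Γ.posSupp b ⊆ Γ.posSupp c) {d : D}
    (hd : c.1 d = 0) : b.1 d = 0 :=
  (nonpos_of_posSupp_subset h hd.le).antisymm (nonneg_of_posSupp_subset h hd.ge)

variable [Fintype D]

/-- The scalar product `pairing` as a bilinear map. -/
noncomputable def pairingₗ (Γ : SerreGraph V D) : Γ.chains ℝ →ₗ[ℝ] Γ.chains ℝ →ₗ[ℝ] ℝ :=
  LinearMap.mk₂ ℝ Γ.pairing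
    (fun a b c => by simp [pairing, add_mul, Finset.sum_add_distrib, mul_add])
    (fun r a b => by simp [pairing, Finset.mul_sum]; congr 1; ext; ring)
    (fun a b c => by simp [pairing, Finset.sum_add_distrib, mul_add])
    (fun r a b => by simp [pairing, Finset.mul_sum]; congr 1; ext; ring)

theorem pairingₗ_apply (x y : Γ.chains ℝ) : Γ.pairingₗ x y = Γ.pairing x y := rfl

theorem pairing_comm (x y : Γ.chains ℝ) : Γ.pairing x y = Γ.pairing y x := by
  simp only [pairing, mul_comm]

theorem pairing_self_eq_zero {x : Γ.chains ℝ} (h : Γ.pairing x x = 0) : x = 0 := by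
  have h' : ∑ d, x.1 d * x.1 d = 0 := by
    simpa [pairing] using h
  rw [Finset.sum_eq_zero_iff_of_nonneg fun d _ => mul_self_nonneg _] at h'
  ext d
  simpa using h' d (Finset.mem_univ d)

theorem bijective_of_injective_dual {E : Type*} [AddCommGroup E] [Module ℝ E]
    [FiniteDimensional ℝ E] (B : E →ₗ[ℝ] E →ₗ[ℝ] ℝ) (hB : Function.Injective B) :
    Function.Bijective B :=
  ⟨hB, (LinearMap.injective_iff_surjective_of_finrank_eq_finrank
    (Subspace.dual_finrank_eq (K := ℝ) (V := E)).symm).1 hB⟩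

/-- The scalar product identifies homology with its dual. -/
theorem bijective_pairingₗ_H1 (Γ : SerreGraph V D) :
    Function.Bijective (Γ.pairingₗ.domRestrict₁₂ (Γ.H1 ℝ) (Γ.H1 ℝ)) := by
  refine bijective_of_injective_dual (E := Γ.H1 ℝ) (Γ.pairingₗ.domRestrict₁₂ (Γ.H1 ℝ) (Γ.H1 ℝ)) ?_
  rw [injective_iff_map_eq_zero]
  intro a ha
  exact Subtype.ext (pairing_self_eq_zero (LinearMap.congr_fun ha a))

theorem exists_pairing_eq (l : Γ.H1 ℝ →ₗ[ℝ] ℝ) :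
    ∃ a : Γ.H1 ℝ, ∀ v : Γ.H1 ℝ, l v = Γ.pairing a v := by
  obtain ⟨a, ha⟩ := Γ.bijective_pairingₗ_H1.2 l
  exact ⟨a, fun v => by rw [← ha]; rfl⟩

/-- The orthogonal projection to homology, defined on all functions on oriented edges. -/
theorem exists_projection (Γ : SerreGraph V D) : ∃ π : (D → ℝ) →ₗ[ℝ] Γ.H1 ℝ,
    ∀ (c : D → ℝ) (v : Γ.H1 ℝ), Γ.pairing v (π c) = (1 / 2) * ∑ d, v.1.1 d * c d := by
  let l : (D → ℝ) →ₗ[ℝ] Γ.H1 ℝ →ₗ[ℝ] ℝ :=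
    LinearMap.mk₂ ℝ (fun c v => (1 / 2) * ∑ d, v.1.1 d * c d)
      (fun a b c => by simp [mul_add, Finset.sum_add_distrib])
      (fun r a b => by simp [Finset.mul_sum]; congr 1; ext; ring)
      (fun a b c => by simp [add_mul, mul_add, Finset.sum_add_distrib])
      (fun r a b => by simp [Finset.mul_sum]; congr 1; ext; ring)
  let B := LinearEquiv.ofBijective _ Γ.bijective_pairingₗ_H1
  refine ⟨B.symm ∘ₗ l, fun c v => ?_⟩
  rw [pairing_comm]
  exact LinearMap.congr_fun (B.apply_symm_apply (l c)) v

open Classical in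
theorem sum_tgt_eq_zero (v : Γ.H1 ℝ) (x : V) : ∑ d with Γ.tgt d = x, v.1.1 d = 0 :=
  congrFun v.2 x

/-- A small multiple of `w` can be added to `v` without changing the signs of nonzero
coefficients. -/
theorem exists_pos_add_smul (v w : Γ.H1 ℝ) :
    ∃ t : ℝ, 0 < t ∧ ∀ d, 0 < v.1.1 d → 0 < (v + t • w).1.1 d := by
  have h : ∀ᶠ t : ℝ in nhdsWithin 0 (Set.Ioi 0), ∀ d, 0 < v.1.1 d → 0 < (v + t • w).1.1 d := by
    rw [Filter.eventually_all]
    intro d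
    by_cases hd : 0 < v.1.1 d
    · have hc : Continuous fun t : ℝ => v.1.1 d + t * w.1.1 d := by fun_prop
      have : ∀ᶠ t : ℝ in nhds 0, 0 < v.1.1 d + t * w.1.1 d :=
        hc.continuousAt.eventually_const_lt (by simpa using hd)
      filter_upwards [nhdsWithin_le_nhds this] with t ht _
      exact ht
    · exact Filter.Eventually.of_forall fun t h => absurd h hd
  obtain ⟨t, ht, ht'⟩ := (h.and self_mem_nhdsWithin).exists
  exact ⟨t, ht', ht⟩

end

/-! ### Totally cyclic orientations and positive circulations -/

section

variable {Γ : SerreGraph V D}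

/-- The oriented edges chosen by the orientation of an element of `OP`. -/
def OP.posSet (p : Γ.OP) : Set D := Set.range fun e => (p.φ.toFun e : D)

theorem OP.eq_or_eq_rev (p : Γ.OP) (d : D) (h : Γ.edge d ∉ p.T) :
    (p.φ.toFun ((Γ.delete p.T).edge ⟨d, h⟩) : D) = d ∨
      (p.φ.toFun ((Γ.delete p.T).edge ⟨d, h⟩) : D) = Γ.rev d := by
  have := p.φ.edge_toFun ((Γ.delete p.T).edge ⟨d, h⟩)
  rw [edge_eq_iff] at this
  rcases this with h | h
  · exact Or.inl (congrArg Subtype.val h).symm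
  · right
    have h' := congrArg Subtype.val h
    change d = Γ.rev _ at h'
    conv_rhs => rw [h', Γ.rev_rev]

theorem OP.posSet_subset_iff {p q : Γ.OP} : p.posSet ⊆ q.posSet ↔ p ≤ q := by
  constructor
  · intro hpq
    have hT : q.T ⊆ p.T := by
      intro e he
      by_contra hep
      induction e using Quotient.inductionOn with
      | h d =>
        obtain ⟨e', he'⟩ := hpq ⟨(Γ.delete p.T).edge ⟨d, hep⟩, rfl⟩
        have hq := (q.φ.toFun e').2
        simp only at he'
        rw [he'] at hq
        rcases p.eq_or_eq_rev d hep with h | h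
        · rw [h] at hq
          exact hq he
        · rw [h, Γ.edge_rev] at hq
          exact hq he
    refine ⟨hT, fun e => ?_⟩
    obtain ⟨e', he'⟩ := hpq ⟨e, rfl⟩
    simp only at he'
    rw [← he']
    congr 2
    have h1 := q.φ.edge_toFun e'
    have h2 := p.φ.edge_toFun e
    rw [← h1, ← h2]
    change _ = (Γ.delete q.T).edge ⟨(p.φ.toFun e).1, _⟩
    congr 1
    exact Subtype.ext he'
  · rintro ⟨hT, h⟩ _ ⟨e, rfl⟩
    exact ⟨_, (h e).symm⟩

theorem OP.rev_notMem_posSet (p : Γ.OP) {d : D} (hd : d ∈ p.posSet) : Γ.rev d ∉ p.posSet := by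
  rintro ⟨e', he'⟩
  obtain ⟨e, he⟩ := hd
  simp only at he he'
  have hee : e = e' := by
    rw [← p.φ.edge_toFun e, ← p.φ.edge_toFun e', edge_eq_iff]
    right
    apply Subtype.ext
    change _ = Γ.rev _
    rw [he', he]
  rw [← hee, he] at he'
  exact Γ.rev_ne d he'.symm

theorem posSupp_sum_subset {ι : Type*} {s : Finset ι} {c : ι → Γ.chains ℝ} {Q : Set D}
    (h : ∀ i ∈ s, Γ.posSupp (c i) ⊆ Q) : Γ.posSupp (∑ i ∈ s, c i) ⊆ Q := by
  intro d hd
  rw [mem_posSupp] at hd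
  simp only [AddSubmonoidClass.coe_finsetSum, Finset.sum_apply] at hd
  obtain ⟨i, hi, hi'⟩ := Finset.exists_lt_of_sum_lt (s := s) (f := fun _ => (0 : ℝ))
    (g := fun i => (c i).1 d) (by simpa using hd)
  exact h i hi hi'

theorem posSupp_add_subset {a b : Γ.chains ℝ} {Q : Set D}
    (ha : Γ.posSupp a ⊆ Q) (hb : Γ.posSupp b ⊆ Q) : Γ.posSupp (a + b) ⊆ Q := by
  intro d hd
  by_contra h
  have h1 : ¬ 0 < a.1 d := fun h' => h (ha h')
  have h2 : ¬ 0 < b.1 d := fun h' => h (hb h')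
  have hd' : 0 < a.1 d + b.1 d := hd
  linarith

theorem posSupp_orientedEdge (d : D) : Γ.posSupp (Γ.orientedEdge ℝ d) = {d} := by
  classical
  ext d'
  simp only [mem_posSupp, orientedEdge, Set.mem_singleton_iff]
  by_cases h : d' = d
  · subst h
    simp [(Γ.rev_ne d').symm]
  · simp only [h, if_false, iff_false, not_lt]
    split_ifs <;> norm_num

open Classical in
/-- A directed path from `x` to `y` gives a chain with boundary `y - x`. -/
theorem exists_chain_of_reachable [Fintype D] {Q : Set D} {x y : V}
    (h : Relation.ReflTransGen (fun x y => ∃ d ∈ Q, Γ.src d = x ∧ Γ.tgt d = y) x y) :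
    ∃ c : Γ.chains ℝ, Γ.posSupp c ⊆ Q ∧
      Γ.boundary ℝ c = Pi.single y 1 - Pi.single x 1 := by
  induction h with
  | refl => exact ⟨0, fun d hd => absurd hd (lt_irrefl (0 : ℝ)), by simp⟩
  | tail _ hyz ih =>
    obtain ⟨c, hc, hb⟩ := ih
    obtain ⟨d, hd, rfl, rfl⟩ := hyz
    refine ⟨c + Γ.orientedEdge ℝ d, posSupp_add_subset hc ?_, ?_⟩
    · simpa [posSupp_orientedEdge] using hd
    · rw [map_add, hb, boundary_orientedEdge]
      abel

/-- Every edge of a totally cyclic orientation lies on a directed cycle: otherwise the vertices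
of its component that cannot be reached from its target violate total cyclicity. -/
theorem OP.reachable (p : Γ.OP) {d : D} (hd : d ∈ p.posSet) :
    Relation.ReflTransGen (fun x y => ∃ d ∈ p.posSet, Γ.src d = x ∧ Γ.tgt d = y)
      (Γ.tgt d) (Γ.src d) := by
  set R : Set V := {y | Relation.ReflTransGen
    (fun x y => ∃ d ∈ p.posSet, Γ.src d = x ∧ Γ.tgt d = y) (Γ.tgt d) y} with hR
  by_contra hsrc
  have hdT : Γ.edge d ∉ p.T := by
    obtain ⟨e, rfl⟩ := hd
    exact (p.φ.toFun e).2
  have hK : Γ.src d ∈ (Γ.delete p.T).component (Γ.tgt d) :=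
    Relation.ReflTransGen.single ⟨⟨Γ.rev d, by rwa [Γ.edge_rev]⟩, by
      change Γ.src (Γ.rev d) = _
      rw [Γ.src_eq, Γ.rev_rev], (Γ.src_eq d).symm⟩
  refine p.totallyCyclic (Γ.tgt d) ⟨(Γ.delete p.T).component (Γ.tgt d) \ R, ⟨_, hK, hsrc⟩,
    ⟨Set.sdiff_subset, fun h => (h Relation.ReflTransGen.refl).2 Relation.ReflTransGen.refl⟩, ?_⟩
  rintro ⟨d', hd'⟩ hs ht
  have hs' : Γ.src d' ∉ R := hs.2
  have htR : Γ.tgt d' ∈ R := by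
    by_contra h
    exact ht.2 ⟨ht.1, h⟩
  have hmem : (p.φ.toFun ((Γ.delete p.T).edge ⟨d', hd'⟩) : D) ∈ p.posSet := ⟨_, rfl⟩
  rcases p.eq_or_eq_rev d' hd' with h | h
  · have : p.φ.toFun ((Γ.delete p.T).edge ⟨d', hd'⟩) = ⟨d', hd'⟩ := Subtype.ext h
    rw [this]
    exact ⟨hs, ht⟩
  · rw [h] at hmem
    refine absurd (Relation.ReflTransGen.tail htR ⟨_, hmem, ?_, ?_⟩) hs'
    · rw [Γ.src_eq, Γ.rev_rev]
    · exact (Γ.src_eq d').symm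

/-- A totally cyclic orientation carries a circulation that is positive on every edge. -/
theorem OP.exists_posSupp_eq [Fintype D] (p : Γ.OP) : ∃ v : Γ.H1 ℝ, Γ.posSupp v = p.posSet := by
  classical
  have h : ∀ d : p.posSet, ∃ c : Γ.chains ℝ, Γ.posSupp c ⊆ p.posSet ∧
      Γ.boundary ℝ (c + Γ.orientedEdge ℝ d) = 0 := by
    intro d
    obtain ⟨c, hc, hb⟩ := exists_chain_of_reachable (p.reachable d.2)
    exact ⟨c, hc, by rw [map_add, hb, boundary_orientedEdge]; abel⟩
  choose c hc hb using h
  have hsub : ∀ d : p.posSet, Γ.posSupp (c d + Γ.orientedEdge ℝ d) ⊆ p.posSet := fun d =>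
    posSupp_add_subset (hc d) (by simp [posSupp_orientedEdge])
  have hnonneg : ∀ (b : Γ.chains ℝ), Γ.posSupp b ⊆ p.posSet → ∀ d ∈ p.posSet, 0 ≤ b.1 d := by
    intro b hb d hd
    by_contra! h
    exact p.rev_notMem_posSet hd (hb (rev_mem_posSupp.2 h))
  refine ⟨⟨∑ d : p.posSet, (c d + Γ.orientedEdge ℝ d), ?_⟩, ?_⟩
  · rw [LinearMap.mem_ker, map_sum]
    exact Finset.sum_eq_zero fun d _ => hb d
  · refine (posSupp_sum_subset fun d _ => hsub d).antisymm fun d hd => ?_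
    rw [mem_posSupp]
    simp only [AddSubmonoidClass.coe_finsetSum, Finset.sum_apply]
    refine Finset.sum_pos' (fun d' _ => hnonneg _ (hsub d') d hd)
      ⟨⟨d, hd⟩, Finset.mem_univ _, ?_⟩
    have h1 := hnonneg _ (hc ⟨d, hd⟩) d hd
    have h2 : 0 < (Γ.orientedEdge ℝ d).1 d := by
      rw [← mem_posSupp, posSupp_orientedEdge]
      rfl
    exact add_pos_of_nonneg_of_pos h1 h2

/-- The net flow of a circulation into a vertex set `W` vanishes. Only the edges entering `W`
from outside are counted, because those inside `W` cancel in pairs. -/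
theorem sum_cut_eq_zero [Fintype D] [Finite V] (v : Γ.H1 ℝ) (W : Set V) [DecidablePred (· ∈ W)] :
    ∑ d with Γ.tgt d ∈ W ∧ Γ.src d ∉ W, v.1.1 d = 0 := by
  classical
  have := Fintype.ofFinite V
  have h1 : ∑ d with Γ.tgt d ∈ W, v.1.1 d = 0 := by
    have : ∑ x with x ∈ W, ∑ d with Γ.tgt d = x, v.1.1 d = 0 :=
      Finset.sum_eq_zero fun x _ => sum_tgt_eq_zero v x
    rw [← this, ← Finset.sum_fiberwise_of_maps_to
      (s := Finset.univ.filter fun d => Γ.tgt d ∈ W)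
      (t := Finset.univ.filter fun x => x ∈ W) (g := Γ.tgt) (by simp)]
    refine Finset.sum_congr rfl fun x hx => Finset.sum_congr ?_ fun _ _ => rfl
    ext d
    simp only [Finset.mem_filter, Finset.mem_univ, true_and] at hx ⊢
    exact ⟨fun h => h.2, fun h => ⟨h ▸ hx, h⟩⟩
  have h2 : ∑ d with Γ.tgt d ∈ W ∧ Γ.src d ∈ W, v.1.1 d = 0 := by
    have : ∑ d with Γ.tgt d ∈ W ∧ Γ.src d ∈ W, v.1.1 d =
        ∑ d with Γ.tgt d ∈ W ∧ Γ.src d ∈ W, - v.1.1 d := by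
      refine Finset.sum_bij' (fun d _ => Γ.rev d) (fun d _ => Γ.rev d) ?_ ?_
        (fun d _ => Γ.rev_rev d) (fun d _ => Γ.rev_rev d) ?_
      · intro d; simp only [Finset.mem_filter, Finset.mem_univ, true_and, Γ.src_eq, Γ.rev_rev]
        exact And.symm
      · intro d; simp only [Finset.mem_filter, Finset.mem_univ, true_and, Γ.src_eq, Γ.rev_rev]
        exact And.symm
      · intro d _
        rw [v.1.2 d, neg_neg]
    rw [Finset.sum_neg_distrib] at this
    linarith
  rw [← Finset.sum_filter_add_sum_filter_not _ (fun d => Γ.src d ∈ W), Finset.filter_filter,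
    Finset.filter_filter, h2, zero_add] at h1
  exact h1

/-- The edges on which a real chain vanishes. -/
def zeroEdges (Γ : SerreGraph V D) (c : Γ.chains ℝ) : Set Γ.Edge :=
  {e | ∀ d, Γ.edge d = e → c.1 d = 0}

theorem edge_mem_zeroEdges {c : Γ.chains ℝ} {d : D} :
    Γ.edge d ∈ Γ.zeroEdges c ↔ c.1 d = 0 := by
  refine ⟨fun h => h d rfl, fun h d' hd' => ?_⟩
  rcases (Γ.edge_eq_iff _ _).1 hd'.symm with rfl | rfl
  · exact h
  · rw [c.2, h, neg_zero]

open Classical in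
/-- The orientation of the support of a real chain along which the chain is positive. -/
noncomputable def posOrientation (c : Γ.chains ℝ) :
    (Γ.delete (Γ.zeroEdges c)).Orientation where
  toFun := Quotient.lift (fun d => if 0 < c.1 d then d else (Γ.delete (Γ.zeroEdges c)).rev d) (by
    rintro a b (rfl | rfl)
    · rfl
    · have ha : c.1 a ≠ 0 := fun h => a.2 (edge_mem_zeroEdges.2 h)
      have hb : c.1 ((Γ.delete (Γ.zeroEdges c)).rev a) = - c.1 a := c.2 a
      rw [hb, (Γ.delete _).rev_rev]
      rcases ha.lt_or_gt with h | h
      · rw [if_neg h.not_gt, if_pos (by linarith)]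
      · rw [if_pos h, if_neg (by linarith)])
  edge_toFun e := by
    induction e using Quotient.inductionOn with
    | h d =>
      change (Γ.delete _).edge (if 0 < c.1 d then d else (Γ.delete (Γ.zeroEdges c)).rev d) = _
      split_ifs
      · rfl
      · exact (Γ.delete _).edge_rev d

theorem posOrientation_pos (c : Γ.chains ℝ) (e : (Γ.delete (Γ.zeroEdges c)).Edge) :
    0 < c.1 ((posOrientation c).toFun e) := by
  classical
  induction e using Quotient.inductionOn with
  | h d =>
    change 0 < c.1 (if 0 < c.1 d then d else (Γ.delete (Γ.zeroEdges c)).rev d : {d // _})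
    have ha : c.1 d ≠ 0 := fun h => d.2 (edge_mem_zeroEdges.2 h)
    split_ifs with h
    · exact h
    · have hb : c.1 ((Γ.delete (Γ.zeroEdges c)).rev d) = - c.1 d := c.2 d
      rw [hb]
      have := lt_of_le_of_ne (not_lt.1 h) ha
      linarith

theorem posOrientation_edge (c : Γ.chains ℝ) {d : D} (h : Γ.edge d ∉ Γ.zeroEdges c)
    (hd : 0 < c.1 d) :
    (posOrientation c).toFun ((Γ.delete (Γ.zeroEdges c)).edge ⟨d, h⟩) = ⟨d, h⟩ :=
  if_pos hd

theorem component_adj {v x y : V} (hx : x ∈ Γ.component v) (d : D) (hs : Γ.src d = x)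
    (ht : Γ.tgt d = y) : y ∈ Γ.component v :=
  Relation.ReflTransGen.tail hx ⟨d, hs, ht⟩

/-- A nonempty proper subset of a component is joined to the rest of the component by an
edge. -/
theorem exists_cut_edge {v : V} {W : Set V} (hW : W.Nonempty) (hWK : W ⊂ Γ.component v) :
    ∃ d, Γ.src d ∈ W ∧ Γ.tgt d ∈ Γ.component v \ W := by
  by_contra! h
  have hstep : ∀ d, Γ.src d ∈ W → Γ.tgt d ∈ W := by
    intro d hd
    by_contra hd'
    exact h d hd ⟨component_adj (hWK.1 hd) d rfl rfl, hd'⟩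
  have hstep' : ∀ d, Γ.tgt d ∈ W → Γ.src d ∈ W := by
    intro d hd
    rw [Γ.src_eq]
    exact hstep _ (by rwa [Γ.src_eq, Γ.rev_rev])
  have hv : v ∈ W := by
    obtain ⟨w, hw⟩ := hW
    have hvw : Relation.ReflTransGen (fun x y => ∃ d, Γ.src d = x ∧ Γ.tgt d = y) v w :=
      hWK.1 hw
    clear h hWK
    induction hvw using Relation.ReflTransGen.head_induction_on with
    | refl => exact hw
    | head hab _ ih =>
      obtain ⟨d, rfl, rfl⟩ := hab
      exact hstep' d ih
  refine hWK.2 fun w hw => ?_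
  have hvw : Relation.ReflTransGen (fun x y => ∃ d, Γ.src d = x ∧ Γ.tgt d = y) v w := hw
  induction hvw with
  | refl => exact hv
  | tail hab hd ih =>
    obtain ⟨d, rfl, rfl⟩ := hd
    exact hstep d (ih hab)

/-- The orientation along which a circulation is positive is totally cyclic: a cut oriented in
one direction would carry nonzero net flow. -/
theorem posOrientation_totallyCyclic [Fintype D] [Finite V] (v : Γ.H1 ℝ) :
    (posOrientation v.1).TotallyCyclic := by
  classical
  rintro x ⟨W, hW, hWK, hcut⟩
  -- Every edge leaving `W` carries positive flow.
  have hpos : ∀ d : {d // Γ.edge d ∉ Γ.zeroEdges v.1}, Γ.src d ∈ W →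
      Γ.tgt d ∈ (Γ.delete (Γ.zeroEdges v.1)).component x \ W → 0 < v.1.1 d := by
    intro d hs ht
    by_contra hd
    have hne : v.1.1 d ≠ 0 := fun h => d.2 (edge_mem_zeroEdges.2 h)
    have hrev : 0 < v.1.1 (Γ.rev d) :=
      rev_mem_posSupp.2 (lt_of_le_of_ne (not_lt.1 hd) hne)
    have h1 := posOrientation_edge v.1 (d := Γ.rev d)
      (by rw [Γ.edge_rev]; exact d.2) hrev
    have h2 := hcut d hs ht
    rw [← (Γ.delete _).edge_rev d] at h2
    erw [h1] at h2
    have h3 : Γ.src (Γ.rev d) ∈ W := h2.1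
    rw [Γ.src_eq, Γ.rev_rev] at h3
    exact ht.2 h3
  obtain ⟨d₀, hs₀, ht₀⟩ := exists_cut_edge hW hWK
  refine (sum_cut_eq_zero v W).not_lt (Finset.sum_neg' (fun d hd => ?_)
    ⟨Γ.rev d₀, ?_, ?_⟩)
  · simp only [Finset.mem_filter, Finset.mem_univ, true_and] at hd
    rw [← neg_nonneg, ← v.1.2]
    by_cases hd0 : v.1.1 d = 0
    · rw [v.1.2, hd0, neg_zero]
    · have hmem : Γ.edge (Γ.rev d) ∉ Γ.zeroEdges v.1 := by
        rw [Γ.edge_rev]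
        exact fun h => hd0 (edge_mem_zeroEdges.1 h)
      have hs : Γ.src (Γ.rev d) ∈ W := by rw [Γ.src_eq, Γ.rev_rev]; exact hd.1
      have ht : Γ.tgt (Γ.rev d) ∉ W := by rw [← Γ.src_eq]; exact hd.2
      exact (hpos ⟨Γ.rev d, hmem⟩ hs ⟨component_adj (Γ := Γ.delete _) (hWK.1 hs)
        ⟨Γ.rev d, hmem⟩ rfl rfl, ht⟩).le
  · simp only [Finset.mem_filter, Finset.mem_univ, true_and]
    exact ⟨by rw [← Γ.src_eq]; exact hs₀, by rw [Γ.src_eq, Γ.rev_rev]; exact ht₀.2⟩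
  · rw [v.1.2, neg_lt_zero]
    exact hpos d₀ hs₀ ht₀

theorem exists_posSet_eq [Fintype D] [Finite V] (v : Γ.H1 ℝ) :
    ∃ p : Γ.OP, p.posSet = Γ.posSupp v := by
  refine ⟨⟨_, posOrientation v.1, posOrientation_totallyCyclic v⟩, ?_⟩
  ext d
  constructor
  · rintro ⟨e, rfl⟩
    exact posOrientation_pos v.1 e
  · intro hd
    have h : Γ.edge d ∉ Γ.zeroEdges v.1 := fun h => hd.ne' (edge_mem_zeroEdges.1 h)
    exact ⟨_, congrArg Subtype.val (posOrientation_edge v.1 h hd)⟩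

end

/-! ### The cographic fan -/

section

variable [Fintype D] {Γ : SerreGraph V D}

/-- The cone of homology classes with positive support in `X`. For `X = posSupp x` it consists of
the classes whose nonzero coefficients have the same sign as those of `x`. -/
def signCone (Γ : SerreGraph V D) (X : Set D) : Set (Γ.H1 ℝ) := {v | Γ.posSupp v ⊆ X}

theorem signCone_posSupp_subset_iff {v : Γ.H1 ℝ} {X : Set D} :
    Γ.signCone (Γ.posSupp v) ⊆ Γ.signCone X ↔ Γ.posSupp v ⊆ X :=
  ⟨fun h => h (subset_rfl : Γ.posSupp v ⊆ Γ.posSupp v), fun h _ hw => Set.Subset.trans hw h⟩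

theorem add_mem_signCone {X : Set D} {v w : Γ.H1 ℝ} (hv : v ∈ Γ.signCone X)
    (hw : w ∈ Γ.signCone X) : v + w ∈ Γ.signCone X :=
  posSupp_add_subset hv hw

/-- The coefficient of an oriented edge, as a continuous linear functional on homology. -/
noncomputable def coordL (Γ : SerreGraph V D) (d : D) : Γ.H1 ℝ →L[ℝ] ℝ :=
  (ContinuousLinearMap.proj d).comp ((Γ.chains ℝ).subtypeL.comp (Γ.H1 ℝ).subtypeL)

/-- The functional exposing `signCone (posSupp y)` in `signCone (posSupp x)` is minus the sum of the
coefficients positive in `x` and zero in `y`. -/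
theorem isFace_signCone {x y : Γ.H1 ℝ} (h : Γ.posSupp y ⊆ Γ.posSupp x) :
    IsFace (Γ.signCone (Γ.posSupp x)) (Γ.signCone (Γ.posSupp y)) := by
  classical
  refine ⟨⟨y, (subset_rfl : Γ.posSupp y ⊆ Γ.posSupp y)⟩, fun _ =>
    ⟨∑ d with 0 < x.1.1 d ∧ y.1.1 d = 0, Γ.coordL (Γ.rev d), ?_⟩⟩
  have hl : ∀ v : Γ.H1 ℝ, (∑ d with 0 < x.1.1 d ∧ y.1.1 d = 0, Γ.coordL (Γ.rev d)) v =
      -∑ d with 0 < x.1.1 d ∧ y.1.1 d = 0, v.1.1 d := by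
    intro v
    rw [sum_apply, ← Finset.sum_neg_distrib]
    exact Finset.sum_congr rfl fun d _ => v.1.2 d
  have hnn : ∀ v ∈ Γ.signCone (Γ.posSupp x), ∀ d ∈ Finset.univ.filter
      (fun d => 0 < x.1.1 d ∧ y.1.1 d = 0), 0 ≤ v.1.1 d := by
    intro v hv d hd
    simp only [Finset.mem_filter, Finset.mem_univ, true_and] at hd
    exact nonneg_of_posSupp_subset hv hd.1.le
  ext v
  simp only [hl, Set.mem_ofPred_eq, neg_le_neg_iff]
  constructor
  · intro hv
    refine ⟨Set.Subset.trans hv h, fun w hw => ?_⟩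
    rw [Finset.sum_eq_zero]
    · exact Finset.sum_nonneg (hnn w hw)
    · intro d hd
      simp only [Finset.mem_filter, Finset.mem_univ, true_and] at hd
      exact eq_zero_of_posSupp_subset hv hd.2
  · rintro ⟨hv, hmax⟩ d hd
    have h0 := hmax 0 (fun d hd => absurd hd (lt_irrefl (0 : ℝ)))
    have hz : ∑ d with 0 < x.1.1 d ∧ y.1.1 d = 0, (0 : Γ.H1 ℝ).1.1 d = 0 :=
      Finset.sum_eq_zero fun _ _ => rfl
    rw [hz] at h0
    have h1 := (Finset.sum_eq_zero_iff_of_nonneg (hnn v hv)).1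
      (h0.antisymm (Finset.sum_nonneg (hnn v hv)))
    have hxd : 0 < x.1.1 d := hv hd
    rw [mem_posSupp]
    refine lt_of_le_of_ne (nonneg_of_posSupp_subset h hxd.le) fun hy => ?_
    have hvd : 0 < v.1.1 d := hd
    exact hvd.ne' (h1 d (by simp [hxd, ← hy]))

/-- A face of a sign cone is the sign cone of one of its members with the largest support. -/
theorem exists_eq_signCone_of_isFace {x : Γ.H1 ℝ} {F : Set (Γ.H1 ℝ)}
    (hF : IsFace (Γ.signCone (Γ.posSupp x)) F) : ∃ y : Γ.H1 ℝ, F = Γ.signCone (Γ.posSupp y) := by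
  obtain ⟨hne, hexp⟩ := hF
  obtain ⟨l, hl⟩ := hexp hne
  -- On a cone, the maximal value of a functional that attains its maximum is zero.
  have hl' : ∀ v ∈ Γ.signCone (Γ.posSupp x), l v ≤ 0 := by
    obtain ⟨u, hu⟩ := hne
    rw [hl] at hu
    intro v hv
    have h1 := hu.2 _ (add_mem_signCone hu.1 hv)
    rw [map_add] at h1
    linarith
  have hF' : ∀ v, v ∈ F ↔ v ∈ Γ.signCone (Γ.posSupp x) ∧ l v = 0 := by
    intro v
    rw [hl]
    constructor
    · rintro ⟨hv, hmax⟩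
      refine ⟨hv, (hl' v hv).antisymm ?_⟩
      simpa using hmax 0 fun d hd => absurd hd (lt_irrefl (0 : ℝ))
    · rintro ⟨hv, h0⟩
      exact ⟨hv, fun w hw => by rw [h0]; exact hl' w hw⟩
  -- A member with the largest support has positive support containing that of every other member,
  -- because members of the face are conformal to `x` and so do not cancel when added.
  obtain ⟨y, hyF, hymax⟩ : ∃ y ∈ F, ∀ v ∈ F, (Γ.posSupp v.1).ncard ≤ (Γ.posSupp y.1).ncard := by
    have hfin : ((fun v : Γ.H1 ℝ => (Γ.posSupp v.1).ncard) '' F).Finite :=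
      (Set.finite_Iic (Set.univ : Set D).ncard).subset (by
        rintro _ ⟨v, _, rfl⟩
        exact Set.ncard_le_ncard (Set.subset_univ _) (Set.toFinite _))
    obtain ⟨y, hy, hmax⟩ := Set.exists_max_image _ id hfin (hne.image _)
    obtain ⟨y, hyF, rfl⟩ := hy
    exact ⟨y, hyF, fun v hv => hmax _ ⟨v, hv, rfl⟩⟩
  have hy := (hF' y).1 hyF
  refine ⟨y, Set.ext fun v => ⟨fun hv => ?_, fun hv => ?_⟩⟩
  · have hv' := (hF' v).1 hv
    have hsum : v + y ∈ F :=
      (hF' _).2 ⟨add_mem_signCone hv'.1 hy.1, by rw [map_add, hv'.2, hy.2, add_zero]⟩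
    have hle : Γ.posSupp y.1 ⊆ Γ.posSupp (v + y).1 := fun d hd =>
      add_pos_of_nonneg_of_pos (nonneg_of_posSupp_subset hv'.1 (hy.1 hd).le) hd
    have heq := Set.eq_of_subset_of_ncard_le hle (hymax _ hsum) (Set.toFinite _)
    change Γ.posSupp v.1 ⊆ Γ.posSupp y.1
    rw [heq]
    exact fun d hd =>
      add_pos_of_pos_of_nonneg hd (nonneg_of_posSupp_subset hy.1 (hv'.1 hd).le)
  · refine (hF' v).2 ⟨Set.Subset.trans hv hy.1, ?_⟩
    -- If `l v < 0`, then `l` would be positive at the point `y - t v` of the cone.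
    obtain ⟨t, ht, hty⟩ := exists_pos_add_smul y ((-1 : ℝ) • v)
    have hmem : y + t • ((-1 : ℝ) • v) ∈ Γ.signCone (Γ.posSupp x) := by
      refine Set.Subset.trans ?_ hy.1
      intro d hd
      by_contra hyd
      have hyd' : y.1.1 d ≤ 0 := not_lt.1 hyd
      have hd' : 0 < (y + t • ((-1 : ℝ) • v)).1.1 d := hd
      rcases hyd'.eq_or_lt with h0 | hneg
      · have hv0 := eq_zero_of_posSupp_subset hv h0
        have he : (y + t • ((-1 : ℝ) • v)).1.1 d = y.1.1 d + t * (-1 * v.1.1 d) := rfl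
        rw [he, h0, hv0] at hd'
        simp at hd'
      · have h1 := hty (Γ.rev d) (rev_mem_posSupp.2 hneg)
        have h2 : (y + t • ((-1 : ℝ) • v)).1.1 d < 0 := rev_mem_posSupp.1 h1
        exact lt_asymm hd' h2
    have h1 := hl' _ hmem
    rw [map_add, hy.2, map_smul, map_smul, zero_add, smul_eq_mul, smul_eq_mul] at h1
    have h2 := hl' v (Set.Subset.trans hv hy.1)
    nlinarith

theorem mem_edgeKer_iff {d : D} {v : Γ.H1 ℝ} : v ∈ Γ.edgeKer (Γ.edge d) ↔ v.1.1 d = 0 := by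
  simp only [edgeKer, Set.mem_ofPred_eq, pairing_orientedEdge]
  exact edge_mem_zeroEdges

/-- A class lies off the arrangement if only the coefficients at bridges vanish. -/
theorem mem_compl_arrangement_iff {v : Γ.H1 ℝ} : v ∈ (Γ.cographicArrangement)ᶜ ↔
    ∀ d, v.1.1 d = 0 → ∀ w : Γ.H1 ℝ, w.1.1 d = 0 := by
  simp only [cographicArrangement, Set.mem_compl_iff, Set.mem_iUnion, not_exists,
    Set.mem_ofPred_eq]
  constructor
  · intro h d hd w
    by_contra hw
    refine h (Γ.edge d) (fun hu => hw ?_) (mem_edgeKer_iff.2 hd)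
    rw [← mem_edgeKer_iff, hu]
    trivial
  · intro h e he hv
    induction e using Quotient.inductionOn with
    | h d =>
      exact he (Set.eq_univ_of_forall fun w => mem_edgeKer_iff.2 (h d (mem_edgeKer_iff.1 hv) w))

theorem posSupp_eq_iff_of_mem_compl {x v : Γ.H1 ℝ} (hx : x ∈ (Γ.cographicArrangement)ᶜ) :
    (∀ d, 0 < x.1.1 d → 0 < v.1.1 d) ↔ Γ.posSupp v = Γ.posSupp x := by
  constructor
  · intro h
    refine Set.Subset.antisymm (fun d hd => ?_) h
    by_contra hxd
    rcases (not_lt.1 hxd : x.1.1 d ≤ 0).eq_or_lt with h0 | hneg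
    · exact (ne_of_gt hd) (mem_compl_arrangement_iff.1 hx d h0 v)
    · exact lt_asymm hd (rev_mem_posSupp.1 (h (Γ.rev d) (rev_mem_posSupp.2 hneg)))
  · intro h d hd
    have : d ∈ Γ.posSupp v.1 := by rw [h]; exact hd
    exact this

theorem continuous_coeff (d : D) : Continuous fun v : Γ.H1 ℝ => v.1.1 d :=
  (Γ.coordL d).continuous

/-- The connected components of the complement of the arrangement are its sign cells. -/
theorem connectedComponentIn_compl_arrangement {x : Γ.H1 ℝ}
    (hx : x ∈ (Γ.cographicArrangement)ᶜ) :
    connectedComponentIn (Γ.cographicArrangement)ᶜ x =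
      {v : Γ.H1 ℝ | Γ.posSupp v = Γ.posSupp x} := by
  have hcell : {v : Γ.H1 ℝ | Γ.posSupp v = Γ.posSupp x} =
      {v : Γ.H1 ℝ | ∀ d, 0 < x.1.1 d → 0 < v.1.1 d} :=
    Set.ext fun v => (posSupp_eq_iff_of_mem_compl hx).symm
  apply Set.Subset.antisymm
  · rw [hcell]
    intro v hv d hd
    by_contra hvd
    have hpre := (isPreconnected_connectedComponentIn
      (x := x) (F := (Γ.cographicArrangement)ᶜ)).image _ (continuous_coeff d).continuousOn
    obtain ⟨u, hu, hu0⟩ := hpre.ordConnected.out ⟨v, hv, rfl⟩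
      ⟨x, mem_connectedComponentIn hx, rfl⟩ (⟨not_lt.1 hvd, hd.le⟩ : (0 : ℝ) ∈ Set.Icc _ _)
    exact hd.ne' (mem_compl_arrangement_iff.1 (connectedComponentIn_subset _ _ hu) d hu0 x)
  · refine IsPreconnected.subset_connectedComponentIn ?_ rfl ?_
    · rw [hcell]
      refine Convex.isPreconnected ?_
      intro v hv w hw a b ha hb hab d hd
      have h1 := hv d hd
      have h2 := hw d hd
      change 0 < a * v.1.1 d + b * w.1.1 d
      rcases ha.eq_or_lt with rfl | ha
      · have : b = 1 := by linarith
        subst this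
        simpa using h2
      · exact add_pos_of_pos_of_nonneg (mul_pos ha h1) (mul_nonneg hb h2.le)
    · intro v hv
      rw [mem_compl_arrangement_iff] at hx ⊢
      intro d hd
      refine hx d (eq_zero_of_posSupp_subset (c := v.1) ?_ hd)
      exact (show Γ.posSupp v = Γ.posSupp x from hv).ge

theorem isClosed_signCone (x : Γ.H1 ℝ) : IsClosed (Γ.signCone (Γ.posSupp x)) := by
  have : Γ.signCone (Γ.posSupp x) = ⋂ d ∈ (Γ.posSupp x)ᶜ, {v : Γ.H1 ℝ | v.1.1 d ≤ 0} := by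
    ext v
    simp only [signCone, Set.mem_ofPred_eq, Set.mem_iInter, Set.mem_compl_iff]
    exact ⟨fun h d hd => not_lt.1 fun hv => hd (h hv),
      fun h d hd => by_contra fun hx => hd.not_ge (h d hx)⟩
  rw [this]
  exact isClosed_biInter fun d _ => isClosed_le (continuous_coeff d) continuous_const

theorem closure_connectedComponentIn {x : Γ.H1 ℝ} (hx : x ∈ (Γ.cographicArrangement)ᶜ) :
    closure (connectedComponentIn (Γ.cographicArrangement)ᶜ x) = Γ.signCone (Γ.posSupp x) := by
  rw [connectedComponentIn_compl_arrangement hx]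
  apply Set.Subset.antisymm
  · exact closure_minimal (fun v hv => (show Γ.posSupp v = Γ.posSupp x from hv).le)
      (isClosed_signCone x)
  · intro v hv
    -- The points `v + t x` with `t > 0` lie in the open cell and converge to `v`.
    have hc : Continuous fun t : ℝ => v + t • x :=
      continuous_induced_rng.2 (continuous_induced_rng.2 (continuous_pi fun d =>
        (continuous_const.add (continuous_id.mul continuous_const) :
          Continuous fun t : ℝ => v.1.1 d + t * x.1.1 d)))
    have hlim : Filter.Tendsto (fun t : ℝ => v + t • x) (nhdsWithin 0 (Set.Ioi 0)) (nhds v) := by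
      have h0 := hc.tendsto 0
      simp only [zero_smul, add_zero] at h0
      exact h0.mono_left nhdsWithin_le_nhds
    refine mem_closure_of_tendsto hlim ?_
    filter_upwards [self_mem_nhdsWithin] with t ht
    refine (posSupp_eq_iff_of_mem_compl hx).1 fun d hd => ?_
    exact add_pos_of_nonneg_of_pos (nonneg_of_posSupp_subset hv hd.le) (mul_pos ht hd)

theorem exists_mem_compl_arrangement (Γ : SerreGraph V D) :
    ∃ w : Γ.H1 ℝ, w ∈ (Γ.cographicArrangement)ᶜ := by
  classical
  let K : D → Submodule ℝ (Γ.H1 ℝ) := fun d => LinearMap.ker (Γ.coordL d).toLinearMap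
  have h := Subspace.biUnion_ne_univ_of_top_notMem (E := Γ.H1 ℝ) (k := ℝ)
    (s := (Finset.univ.image K).erase ⊤) (Finset.notMem_erase _ _)
  obtain ⟨w, hw⟩ := (Set.ne_univ_iff_exists_notMem _).1 h
  refine ⟨w, mem_compl_arrangement_iff.2 fun d hd => ?_⟩
  by_contra! hne
  obtain ⟨u, hu⟩ := hne
  refine hw (Set.mem_biUnion (x := K d) (Finset.mem_erase.2
    ⟨fun htop => hu ?_, Finset.mem_image_of_mem K (Finset.mem_univ d)⟩) hd)
  have : u ∈ K d := by
    rw [htop]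
    trivial
  exact this

/-- Every class is conformal to one off the arrangement, obtained by a small generic
perturbation. -/
theorem exists_posSupp_subset_compl_arrangement (y : Γ.H1 ℝ) :
    ∃ x ∈ (Γ.cographicArrangement)ᶜ, Γ.posSupp y ⊆ Γ.posSupp x.1 := by
  obtain ⟨w, hw⟩ := Γ.exists_mem_compl_arrangement
  obtain ⟨t, ht, hty⟩ := exists_pos_add_smul y w
  refine ⟨y + t • w, mem_compl_arrangement_iff.2 fun d hd => ?_, hty⟩
  have hy : y.1.1 d = 0 := eq_zero_of_posSupp_subset (b := y.1) (c := (y + t • w).1) hty hd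
  have hd' : y.1.1 d + t * w.1.1 d = 0 := hd
  rw [hy, zero_add] at hd'
  exact mem_compl_arrangement_iff.1 hw d ((mul_eq_zero.1 hd').resolve_left ht.ne')

theorem cographicFan_eq (Γ : SerreGraph V D) :
    Γ.cographicFan = Set.range fun v : Γ.H1 ℝ => Γ.signCone (Γ.posSupp v) := by
  ext σ
  constructor
  · rintro ⟨x, hx, hσ⟩
    rw [closure_connectedComponentIn hx] at hσ
    obtain ⟨y, rfl⟩ := exists_eq_signCone_of_isFace hσ
    exact ⟨y, rfl⟩
  · rintro ⟨y, rfl⟩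
    obtain ⟨x, hx, hyx⟩ := exists_posSupp_subset_compl_arrangement y
    refine ⟨x, hx, ?_⟩
    rw [closure_connectedComponentIn hx]
    exact isFace_signCone hyx

end

/-! ### Conformal integral circulations -/

section

variable [Fintype D] {Γ : SerreGraph V D}

theorem nonempty_periodicPts {α : Type*} [Finite α] [Nonempty α] (f : α → α) :
    (Function.periodicPts f).Nonempty := by
  obtain ⟨x⟩ := ‹Nonempty α›
  obtain ⟨m, n, hmn, h⟩ := Finite.exists_ne_map_eq_of_infinite fun n : ℕ => f^[n] x
  wlog hlt : m < n generalizing m n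
  · exact this n m hmn.symm h.symm (lt_of_le_of_ne (not_lt.1 hlt) hmn.symm)
  refine ⟨f^[m] x, Function.mk_mem_periodicPts (Nat.sub_pos_of_lt hlt) ?_⟩
  change f^[n - m] (f^[m] x) = f^[m] x
  rw [← Function.iterate_add_apply, Nat.sub_add_cancel hlt.le]
  exact h.symm

theorem exists_pos_src_eq_tgt (v : Γ.H1 ℝ) {d : D} (hd : 0 < v.1.1 d) :
    ∃ d', 0 < v.1.1 d' ∧ Γ.src d' = Γ.tgt d := by
  classical
  by_contra! h
  refine (sum_tgt_eq_zero v (Γ.tgt d)).not_gt (Finset.sum_pos' (fun b hb => ?_) ⟨d, by simp, hd⟩)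
  simp only [Finset.mem_filter, Finset.mem_univ, true_and] at hb
  by_contra! hneg
  refine h (Γ.rev b) (rev_mem_posSupp.2 hneg) ?_
  rw [Γ.src_eq, Γ.rev_rev, hb]

/-- Every nonzero real circulation `v` is conformal to a nonzero integral circulation with
coefficients in `{-1, 0, 1}`. After each edge with positive flow one can choose another one
continuing it; the periodic edges of this choice form a union of closed walks. -/
theorem exists_integral_circulation (v : Γ.H1 ℝ) (hv : (Γ.posSupp v.1).Nonempty) :
    ∃ l : Γ.H1 ℤ, (∃ d, 0 < l.1.1 d) ∧ ∀ d, 0 < l.1.1 d → l.1.1 d = 1 ∧ 0 < v.1.1 d := by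
  classical
  have hnext : ∀ d : Γ.posSupp v.1, ∃ d' : Γ.posSupp v.1, Γ.src d' = Γ.tgt d := fun d => by
    obtain ⟨d', h1, h2⟩ := exists_pos_src_eq_tgt v d.2
    exact ⟨⟨d', h1⟩, h2⟩
  choose f hf using hnext
  have : Nonempty (Γ.posSupp v.1) := hv.to_subtype
  obtain ⟨q₀, hq₀⟩ := nonempty_periodicPts f
  have hbij : Function.Bijective
      (Set.MapsTo.restrict f _ _ (Function.bijOn_periodicPts f).mapsTo) :=
    (Function.bijOn_periodicPts f).bijective
  let l : Γ.chains ℤ := ∑ q : Function.periodicPts f, Γ.orientedEdge ℤ q.1.1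
  have hcoeff : ∀ d, l.1 d = ∑ q : Function.periodicPts f,
      ((if d = q.1.1 then 1 else 0) - (if d = Γ.rev q.1.1 then 1 else 0)) := by
    intro d
    simp only [l, AddSubmonoidClass.coe_finsetSum, Finset.sum_apply]
    exact Finset.sum_congr rfl fun q _ => by simp only [orientedEdge]
  have hone : ∀ q : Function.periodicPts f, l.1 q.1.1 = 1 := by
    intro q
    rw [hcoeff, Finset.sum_eq_single q]
    · simp [(Γ.rev_ne _).symm]
    · intro q' _ hne
      have h1 : q.1.1 ≠ q'.1.1 := fun h => hne (Subtype.ext (Subtype.ext h.symm))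
      have h2 : q.1.1 ≠ Γ.rev q'.1.1 := fun h => by
        have h3 : Γ.rev q'.1.1 ∈ Γ.posSupp v.1 := h ▸ q.1.2
        exact lt_asymm (rev_mem_posSupp.1 h3) q'.1.2
      simp [h1, h2]
    · simp
  refine ⟨⟨l, ?_⟩, ⟨q₀.1, ?_⟩, fun d hd => ?_⟩
  · rw [LinearMap.mem_ker, map_sum]
    simp only [boundary_orientedEdge, Finset.sum_sub_distrib]
    rw [sub_eq_zero, ← hbij.sum_comp fun q : Function.periodicPts f =>
      (Pi.single (Γ.src q.1.1) 1 : V → ℤ)]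
    refine Finset.sum_congr rfl fun q _ => ?_
    rw [← hf q.1]
    rfl
  · exact (hone ⟨q₀, hq₀⟩).symm ▸ one_pos
  · have hd' : 0 < l.1 d := hd
    rw [hcoeff] at hd'
    obtain ⟨q, -, hq⟩ := Finset.exists_lt_of_sum_lt (f := fun _ => (0 : ℤ))
      (Finset.sum_const_zero.trans_lt hd')
    have : d = q.1.1 := by
      by_contra hne
      simp only [hne, if_false] at hq
      split_ifs at hq <;> simp at hq
    subst this
    exact ⟨hone q, q.1.2⟩

end

/-! ### The Voronoi polytope as a zonotope -/

section

variable {Γ : SerreGraph V D}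

/-- Half of the signs of the coefficients of `a`: a point of the cube at which the functional
given by `a` is maximal. -/
noncomputable def halfSign (a : Γ.chains ℝ) (d : D) : ℝ := (SignType.sign (a.1 d) : ℝ) * (1 / 2)

theorem abs_halfSign_le (a : Γ.chains ℝ) (d : D) : |halfSign a d| ≤ 1 / 2 := by
  rcases lt_trichotomy (a.1 d) 0 with h | h | h <;> simp [halfSign, h]

variable [Fintype D]

/-- The maximum of `pairing a` on the Voronoi polytope: half of the `ℓ¹`-norm of `a` over
unoriented edges, hence a quarter of the sum over both orientations. -/
noncomputable def width (Γ : SerreGraph V D) (a : Γ.chains ℝ) : ℝ := (1 / 4) * ∑ d, |a.1 d|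

theorem mem_voronoi_iff {r : Γ.H1 ℝ} : r ∈ Γ.voronoi ↔
    ∀ l : Γ.H1 ℤ, Γ.pairing (Γ.intCast l) r ≤ (1 / 2) * Γ.pairing (Γ.intCast l) (Γ.intCast l) := by
  refine forall_congr' fun l => ?_
  have h : Γ.pairing (r - Γ.intCast l : Γ.H1 ℝ) (r - Γ.intCast l : Γ.H1 ℝ) =
      Γ.pairing r r - 2 * Γ.pairing (Γ.intCast l) r +
        Γ.pairing (Γ.intCast l) (Γ.intCast l) := by
    rw [Submodule.coe_sub]
    simp only [← pairingₗ_apply, map_sub, LinearMap.sub_apply]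
    simp only [pairingₗ_apply, pairing_comm (r : Γ.chains ℝ) (Γ.intCast l)]
    ring
  rw [h]
  constructor <;> intro h <;> linarith

/-- Subtracting conformal integral circulations from `a` one after the other writes `a` as a
conformal nonnegative combination of them, and the inequalities defining the Voronoi polytope
add up. -/
theorem pairing_le_width {r : Γ.H1 ℝ} (hr : r ∈ Γ.voronoi) (a : Γ.H1 ℝ) :
    Γ.pairing a r ≤ Γ.width a := by
  classical
  induction hn : (Γ.posSupp a.1).ncard using Nat.strong_induction_on generalizing a with
  | _ n ih =>
  rcases (Γ.posSupp a.1).eq_empty_or_nonempty with h0 | hne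
  · have ha : a = 0 := by
      ext d
      refine le_antisymm (not_lt.1 fun h => ?_) (not_lt.1 fun h => ?_)
      · exact (Set.eq_empty_iff_forall_notMem.1 h0) d h
      · exact (Set.eq_empty_iff_forall_notMem.1 h0) (Γ.rev d) (rev_mem_posSupp.2 h)
    subst ha
    simp [pairing, width]
  obtain ⟨l, ⟨d₁, hd₁⟩, hl⟩ := exists_integral_circulation a hne
  -- The largest multiple `t` of `l` for which `a - t l` is still conformal to `a` is the smallest
  -- coefficient of `a` on the positive support of `l`; it kills the coefficient at `d₀`.
  obtain ⟨d₀, hd₀, hmin⟩ := Finset.exists_min_image (Finset.univ.filter fun d => 0 < l.1.1 d)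
    (fun d => a.1.1 d) ⟨d₁, by simpa using hd₁⟩
  simp only [Finset.mem_filter, Finset.mem_univ, true_and] at hd₀ hmin
  set t := a.1.1 d₀ with ht
  have htpos : 0 < t := (hl d₀ hd₀).2
  let b : Γ.H1 ℝ := a - t • Γ.intCast l
  have hb : ∀ d, b.1.1 d = a.1.1 d - t * (l.1.1 d : ℝ) := fun d => rfl
  have hlneg : ∀ d, l.1.1 d < 0 → l.1.1 d = -1 ∧ a.1.1 d ≤ -t := by
    intro d hd
    have h1 : 0 < l.1.1 (Γ.rev d) := by rw [l.1.2 d]; omega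
    have h2 := (hl _ h1).1
    have h3 := hmin _ h1
    rw [l.1.2 d] at h2
    rw [a.1.2 d] at h3
    exact ⟨by omega, by linarith⟩
  have hlpos : ∀ d, 0 < l.1.1 d → l.1.1 d = 1 ∧ t ≤ a.1.1 d := fun d hd =>
    ⟨(hl d hd).1, hmin d hd⟩
  have habs : ∀ d, |a.1.1 d| = |b.1.1 d| + t * ((l.1.1 d : ℝ) * l.1.1 d) := by
    intro d
    rw [hb]
    rcases lt_trichotomy (l.1.1 d) 0 with h | h | h
    · obtain ⟨h1, h2⟩ := hlneg d h
      rw [h1, abs_of_nonpos (by linarith), abs_of_nonpos (by push_cast; linarith)]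
      push_cast
      ring
    · simp [h]
    · obtain ⟨h1, h2⟩ := hlpos d h
      rw [h1, abs_of_nonneg (by linarith), abs_of_nonneg (by push_cast; linarith)]
      push_cast
      ring
  have hlt : (Γ.posSupp b.1).ncard < n := by
    rw [← hn]
    refine Set.ncard_lt_ncard (Set.ssubset_iff_subset_ne.2 ⟨fun d hd => ?_, fun he => ?_⟩)
      (Set.toFinite _)
    · have hd' : 0 < a.1.1 d - t * (l.1.1 d : ℝ) := hd
      change 0 < a.1.1 d
      rcases lt_trichotomy (l.1.1 d) 0 with h | h | h
      · obtain ⟨h1, h2⟩ := hlneg d h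
        rw [h1] at hd'
        push_cast at hd'
        linarith
      · simpa [h] using hd'
      · exact (hl d h).2
    · have h1 : d₀ ∈ Γ.posSupp b.1 := by rw [he]; exact htpos
      have h2 : 0 < a.1.1 d₀ - t * (l.1.1 d₀ : ℝ) := h1
      rw [(hl d₀ hd₀).1, ← ht] at h2
      simp at h2
  have hbr := ih _ hlt b rfl
  have hlr := mul_le_mul_of_nonneg_left (mem_voronoi_iff.1 hr l) htpos.le
  have hab : Γ.pairing a r = Γ.pairing b r + t * Γ.pairing (Γ.intCast l) r := by
    have : (a : Γ.chains ℝ) = b + t • (Γ.intCast l : Γ.chains ℝ) := by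
      simp [b]
    rw [this]
    simp only [← pairingₗ_apply, map_add, map_smul, LinearMap.add_apply, LinearMap.smul_apply,
      smul_eq_mul]
  have hw : Γ.width a = Γ.width b + t * ((1 / 2) * Γ.pairing (Γ.intCast l) (Γ.intCast l)) := by
    have hp : Γ.pairing (Γ.intCast l) (Γ.intCast l) =
        (1 / 2) * ∑ d, (l.1.1 d : ℝ) * l.1.1 d := rfl
    rw [hp, width, width, Finset.sum_congr rfl fun d _ => habs d, Finset.sum_add_distrib,
      ← Finset.mul_sum]
    ring
  linarith

theorem half_sum_le_width (a : Γ.chains ℝ) {c : D → ℝ} (hc : ∀ d, |c d| ≤ 1 / 2) :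
    (1 / 2) * ∑ d, a.1 d * c d ≤ Γ.width a := by
  have h : ∑ d, a.1 d * c d ≤ ∑ d, |a.1 d| * (1 / 2) := by
    refine Finset.sum_le_sum fun d _ => (le_abs_self _).trans ?_
    rw [abs_mul]
    exact mul_le_mul_of_nonneg_left (hc d) (abs_nonneg _)
  rw [← Finset.sum_mul] at h
  rw [width]
  linarith

theorem half_sum_eq_width_iff (a : Γ.chains ℝ) {c : D → ℝ} (hc : ∀ d, |c d| ≤ 1 / 2) :
    (1 / 2) * ∑ d, a.1 d * c d = Γ.width a ↔ ∀ d, a.1 d * c d = |a.1 d| * (1 / 2) := by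
  have hle : ∀ d ∈ Finset.univ, a.1 d * c d ≤ |a.1 d| * (1 / 2) := by
    intro d _
    refine (le_abs_self _).trans ?_
    rw [abs_mul]
    exact mul_le_mul_of_nonneg_left (hc d) (abs_nonneg _)
  have h := Finset.sum_eq_sum_iff_of_le hle
  simp only [Finset.mem_univ, forall_const] at h
  rw [← h, ← Finset.sum_mul, width]
  constructor <;> intro h <;> linarith

theorem half_sum_halfSign (a : Γ.chains ℝ) :
    (1 / 2) * ∑ d, a.1 d * halfSign a d = Γ.width a := by
  rw [half_sum_eq_width_iff _ (abs_halfSign_le a)]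
  intro d
  rw [halfSign, ← mul_assoc, self_mul_sign]

/-- The Voronoi polytope is the projection of the cube of side one. The cube is taken among all
functions on oriented edges: only the odd part of a function, which lies in the cube of chains,
contributes to its projection. -/
theorem mem_voronoi_iff_exists_cube {π : (D → ℝ) →ₗ[ℝ] Γ.H1 ℝ}
    (hπ : ∀ (c : D → ℝ) (v : Γ.H1 ℝ), Γ.pairing v (π c) = (1 / 2) * ∑ d, v.1.1 d * c d)
    {r : Γ.H1 ℝ} : r ∈ Γ.voronoi ↔ ∃ c : D → ℝ, (∀ d, |c d| ≤ 1 / 2) ∧ π c = r := by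
  constructor
  · intro hr
    let ι : Γ.H1 ℝ →ₗ[ℝ] (D → ℝ) := (Γ.chains ℝ).subtype ∘ₗ (Γ.H1 ℝ).subtype
    have hι : Function.Injective ι := fun x y h => Subtype.ext (Subtype.ext h)
    let L : (D → ℝ) →ₗ[ℝ] (D → ℝ) := ι ∘ₗ π
    have hcube : ∀ c : D → ℝ, c ∈ Set.Icc (fun _ => -(1 / 2)) (fun _ => 1 / 2) ↔
        ∀ d, |c d| ≤ 1 / 2 := fun c => by
      simp only [Set.mem_Icc, Pi.le_def, abs_le, forall_and]
    by_contra hne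
    have hconv : Convex ℝ (L '' Set.Icc (fun _ => -(1 / 2)) (fun _ => 1 / 2)) :=
      (convex_Icc _ _).linear_image L
    have hcomp : IsCompact (L '' Set.Icc (fun _ => -(1 / 2)) (fun _ => 1 / 2)) :=
      isCompact_Icc.image L.continuous_of_finiteDimensional
    have hnot : ι r ∉ L '' Set.Icc (fun _ => -(1 / 2)) (fun _ => 1 / 2) := by
      rintro ⟨c, hc, hcr⟩
      exact hne ⟨c, (hcube c).1 hc, hι hcr⟩
    obtain ⟨f, u, hf, hu⟩ := geometric_hahn_banach_closed_point hconv hcomp.isClosed hnot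
    obtain ⟨a, ha⟩ := exists_pairing_eq (f.toLinearMap ∘ₗ ι)
    have ha' : ∀ v, f (ι v) = Γ.pairing a v := ha
    have h1 := hf _ ⟨halfSign a.1, (hcube _).2 (abs_halfSign_le _), rfl⟩
    have h2 : f (L (halfSign a.1)) = Γ.width a := by
      change f (ι (π _)) = _
      rw [ha', hπ, half_sum_halfSign]
    have h3 := pairing_le_width hr a
    rw [← ha'] at h3
    linarith
  · rintro ⟨c, hc, rfl⟩
    rw [mem_voronoi_iff]
    intro l
    rw [hπ]
    refine (half_sum_le_width _ hc).trans ?_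
    have hp : Γ.pairing (Γ.intCast l) (Γ.intCast l) =
        (1 / 2) * ∑ d, (l.1.1 d : ℝ) * l.1.1 d := rfl
    have : ∑ d, |(Γ.intCast l).1.1 d| ≤ ∑ d, (l.1.1 d : ℝ) * l.1.1 d := by
      refine Finset.sum_le_sum fun d _ => ?_
      change |(l.1.1 d : ℝ)| ≤ _
      -- An integer satisfies `|k| ≤ k ^ 2`.
      have hk : |l.1.1 d| ≤ l.1.1 d * l.1.1 d := by
        rw [← abs_mul_abs_self]
        rcases (abs_nonneg (l.1.1 d)).eq_or_lt with h | h
        · simp [← h]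
        · exact le_mul_of_one_le_left (abs_nonneg _) h
      exact_mod_cast hk
    rw [hp, width]
    linarith

/-! ### Faces and normal cones of the Voronoi polytope -/

/-- The face of the Voronoi polytope on which `pairing a` attains its maximum. -/
noncomputable def voronoiFace (Γ : SerreGraph V D) (a : Γ.H1 ℝ) : Set (Γ.H1 ℝ) :=
  {r | r ∈ Γ.voronoi ∧ Γ.pairing a r = Γ.width a}

/-- The center of `voronoiFace a`: it lies on `voronoiFace b` only if `b` is conformal to `a`. -/
theorem exists_mem_voronoiFace (a : Γ.H1 ℝ) : ∃ r ∈ Γ.voronoiFace a,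
    ∀ b : Γ.H1 ℝ, r ∈ Γ.voronoiFace b → Γ.posSupp b ⊆ Γ.posSupp a := by
  obtain ⟨π, hπ⟩ := Γ.exists_projection
  refine ⟨π (halfSign a.1),
    ⟨(mem_voronoi_iff_exists_cube hπ).2 ⟨_, abs_halfSign_le _, rfl⟩, ?_⟩, ?_⟩
  · rw [hπ, half_sum_halfSign]
  · rintro b ⟨-, hb⟩ d hd
    rw [hπ, half_sum_eq_width_iff _ (abs_halfSign_le _)] at hb
    have hd' : 0 < b.1.1 d := hd
    have h1 := hb d
    rw [abs_of_pos hd'] at h1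
    have h2 : (SignType.sign (a.1.1 d) : ℝ) * (1 / 2) = 1 / 2 := mul_left_cancel₀ hd'.ne' h1
    by_contra hna
    rcases (not_lt.1 hna : a.1.1 d ≤ 0).eq_or_lt with h | h
    · rw [h] at h2
      norm_num at h2
    · rw [sign_neg h] at h2
      norm_num at h2

theorem voronoiFace_subset_iff {a b : Γ.H1 ℝ} :
    Γ.voronoiFace a ⊆ Γ.voronoiFace b ↔ Γ.posSupp b ⊆ Γ.posSupp a := by
  constructor
  · intro h
    obtain ⟨r, hr, hr'⟩ := exists_mem_voronoiFace a
    exact hr' b (h hr)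
  · rintro h r ⟨hr, har⟩
    refine ⟨hr, ?_⟩
    obtain ⟨π, hπ⟩ := Γ.exists_projection
    obtain ⟨c, hc, rfl⟩ := (mem_voronoi_iff_exists_cube hπ).1 hr
    rw [hπ, half_sum_eq_width_iff _ hc] at har ⊢
    intro d
    have h1 := har d
    rcases lt_trichotomy (b.1.1 d) 0 with hb | hb | hb
    · have ha : a.1.1 d < 0 := rev_mem_posSupp.1 (h (rev_mem_posSupp.2 hb))
      rw [abs_of_neg ha] at h1
      have h2 : c d = -(1 / 2) := mul_left_cancel₀ ha.ne (by linarith)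
      rw [abs_of_neg hb, h2]
      ring
    · rw [hb]
      simp
    · have ha : 0 < a.1.1 d := h hb
      rw [abs_of_pos ha] at h1
      rw [abs_of_pos hb, mul_left_cancel₀ ha.ne' h1]

theorem isFace_voronoi_iff {F : Set (Γ.H1 ℝ)} :
    IsFace Γ.voronoi F ↔ ∃ a, F = Γ.voronoiFace a := by
  have key : ∀ a : Γ.H1 ℝ, {r | r ∈ Γ.voronoi ∧ ∀ y ∈ Γ.voronoi,
      Γ.pairing a y ≤ Γ.pairing a r} = Γ.voronoiFace a := by
    intro a
    obtain ⟨r₀, hr₀, -⟩ := exists_mem_voronoiFace a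
    ext r
    constructor
    · rintro ⟨hr, hmax⟩
      exact ⟨hr, (pairing_le_width hr a).antisymm (hr₀.2 ▸ hmax r₀ hr₀.1)⟩
    · rintro ⟨hr, h⟩
      exact ⟨hr, fun y hy => by rw [h]; exact pairing_le_width hy a⟩
  constructor
  · rintro ⟨hne, hexp⟩
    obtain ⟨l, hl⟩ := hexp hne
    obtain ⟨a, ha⟩ := exists_pairing_eq l.toLinearMap
    have ha' : ∀ v, l v = Γ.pairing a v := ha
    refine ⟨a, ?_⟩
    rw [hl, ← key]
    simp only [ha']
  · rintro ⟨a, rfl⟩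
    obtain ⟨r₀, hr₀, -⟩ := exists_mem_voronoiFace a
    have hc : Continuous fun v : Γ.H1 ℝ => Γ.pairing a v :=
      continuous_const.mul
        (continuous_finsetSum _ fun d _ => continuous_const.mul (continuous_coeff d))
    refine ⟨⟨r₀, hr₀⟩, fun _ =>
      ⟨⟨(Γ.pairingₗ.domRestrict₁₂ (Γ.H1 ℝ) (Γ.H1 ℝ)) a, hc⟩, (key a).symm⟩⟩

theorem normalCone_voronoiFace (a : Γ.H1 ℝ) :
    Γ.normalCone (Γ.voronoiFace a) = Γ.signCone (Γ.posSupp a) := by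
  ext b
  change _ ↔ Γ.posSupp b ⊆ Γ.posSupp a
  rw [← voronoiFace_subset_iff]
  obtain ⟨r₀, hr₀, -⟩ := exists_mem_voronoiFace b
  constructor
  · intro hb r hr
    exact ⟨hr.1, (pairing_le_width hr.1 b).antisymm (hr₀.2 ▸ hb r hr r₀ hr₀.1)⟩
  · intro h r hr r' hr'
    rw [(h hr).2]
    exact pairing_le_width hr' b

theorem normalFan_eq (Γ : SerreGraph V D) :
    Γ.normalFan = Set.range fun v : Γ.H1 ℝ => Γ.signCone (Γ.posSupp v) := by
  ext C
  constructor
  · rintro ⟨δ, hδ, rfl⟩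
    obtain ⟨a, rfl⟩ := isFace_voronoi_iff.1 hδ
    exact ⟨a, (normalCone_voronoiFace a).symm⟩
  · rintro ⟨a, rfl⟩
    exact ⟨_, isFace_voronoi_iff.2 ⟨a, rfl⟩, (normalCone_voronoiFace a).symm⟩

end

/-! ### The isomorphisms -/

theorem orderIso_range_signCone [Finite V] [Fintype D] (Γ : SerreGraph V D) :
    Nonempty (Γ.OP ≃o Set.range fun v : Γ.H1 ℝ => Γ.signCone (Γ.posSupp v)) := by
  have hmem : ∀ p : Γ.OP, Γ.signCone p.posSet ∈
      Set.range fun v : Γ.H1 ℝ => Γ.signCone (Γ.posSupp v) := by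
    intro p
    obtain ⟨v, hv⟩ := p.exists_posSupp_eq
    exact ⟨v, by simp only [hv]⟩
  let f : Γ.OP ↪o Set.range fun v : Γ.H1 ℝ => Γ.signCone (Γ.posSupp v) :=
    OrderEmbedding.ofMapLEIff (fun p => ⟨Γ.signCone p.posSet, hmem p⟩) (by
      intro p q
      obtain ⟨v, hv⟩ := p.exists_posSupp_eq
      change Γ.signCone p.posSet ⊆ Γ.signCone q.posSet ↔ _
      rw [← OP.posSet_subset_iff, ← hv, signCone_posSupp_subset_iff])
  refine ⟨RelIso.ofSurjective f ?_⟩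
  rintro ⟨_, v, rfl⟩
  obtain ⟨p, hp⟩ := exists_posSet_eq v
  exact ⟨p, Subtype.ext (congrArg Γ.signCone hp)⟩

theorem orderIso_voronoiFaces [Finite V] [Fintype D] (Γ : SerreGraph V D) :
    Nonempty (Γ.OP ≃o (Γ.VoronoiFaces)ᵒᵈ) := by
  choose v hv using fun p : Γ.OP => p.exists_posSupp_eq
  let f : Γ.OP ↪o (Γ.VoronoiFaces)ᵒᵈ :=
    OrderEmbedding.ofMapLEIff
      (fun p => OrderDual.toDual ⟨Γ.voronoiFace (v p), isFace_voronoi_iff.2 ⟨_, rfl⟩⟩) (by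
      intro p q
      change Γ.voronoiFace (v q) ⊆ Γ.voronoiFace (v p) ↔ _
      rw [voronoiFace_subset_iff, hv, hv, OP.posSet_subset_iff])
  refine ⟨RelIso.ofSurjective f fun F => ?_⟩
  obtain ⟨a, ha⟩ := isFace_voronoi_iff.1 (OrderDual.ofDual F).2
  obtain ⟨p, hp⟩ := exists_posSet_eq a
  refine ⟨p, Subtype.ext ?_⟩
  change Γ.voronoiFace (v p) = (OrderDual.ofDual F).1
  have h : Γ.posSupp (v p) = Γ.posSupp a := (hv p).trans hp
  rw [ha]
  exact (voronoiFace_subset_iff.2 h.ge).antisymm (voronoiFace_subset_iff.2 h.le)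

end SerreGraph

theorem mainTheorem4 {V D : Type*} [Finite V] [Fintype D] (Γ : SerreGraph V D) :
    Nonempty (Γ.OP ≃o (Γ.VoronoiFaces)ᵒᵈ) ∧
    Nonempty (Γ.OP ≃o Γ.normalFan) ∧
    Nonempty (Γ.OP ≃o Γ.cographicFan) := by
  refine ⟨Γ.orderIso_voronoiFaces, ?_, ?_⟩
  · rw [Γ.normalFan_eq]
    exact Γ.orderIso_range_signCone
  · rw [Γ.cographicFan_eq]
    exact Γ.orderIso_range_signCone
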